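/- Let $G$ be a finite simple graph with set $A$ of (symmetric) arcs; $o(e),t(e),\bar e$ denote origin, terminus and inverse of an arc. Let $\rho$ be a permutation of $A$ which, for each vertex $x$, permutes $\{e\in A: t(e)=x\}$ in a single cycle, and let $\tau:A\to\mathbb Z_2$ satisfy $\tau(\bar e)=\tau(e)$. Let $G^\tau$ be the double covering graph on $X\times\mathbb Z_2$, where $(x,j)\sim(y,k)$ iff $x\sim y$ in $G$ and $k=j+\tau((x,y))$, with the rotation $\tilde\rho$ that acts as $\rho$ on the arcs ending in sheet $0$ and as $\rho^{-1}$ on those ending in sheet $1$. The blow-up graph of $(G^\tau,\tilde\rho)$ has the arcs $v$ of $G^\tau$ as vertices; its arcs are the island arcs $A_{is}=\{(v,\tilde\rho(v))\}$ and the bridge arcs $A_{br}=\{(v,\bar v)\}$. For a bridge arc $e=(v,\bar v)$ put $\bar e=(\bar v,v)$, let $\tau(e)$ be the twist of the edge of $G$ below $v$, and let $\mathrm{is}(e)$, $\mathrm{is}^\sharp(e)$ be the island arcs with terminus, respectively origin, $o(e)$. For an island arc $\xi$ let $\mathrm{br}(\xi)$ be the bridge arc with terminus $o(\xi)$, and $\tilde\rho^{-1}(\xi)$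 the island arc with terminus $o(\xi)$. Hedgehog assumption: into every island arc $\xi$ a semi-infinite path (tail) is inserted, that is, $\xi$ is divided into two quay arcs, $\xi^-$ from $o(\xi)$ to a new boundary vertex $x_\xi$ and $\xi^+$ from $x_\xi$ to $t(\xi)$, and a tail is attached at its root $x_\xi$. The arcs of the tail directed towards the root are $\epsilon_{\xi,0},\epsilon_{\xi,1},\dots$ with $t(\epsilon_{\xi,0})=x_\xi$ and $t(\epsilon_{\xi,j+1})=o(\epsilon_{\xi,j})$. The set of boundary vertices is $\delta X$; in the notation $t(\mathrm{is}^\sharp(\bar e))$ below the island arc $\xi=\mathrm{is}^\sharp(\bar e)$ is read as $\xi^-$, so that this is $x_\xi\in\delta X$. Let $C=\begin{bmatrix}a&b\\c&d\end{bmatrix}$ be unitary with $d\in\mathbb R$ and $bc\neq0$, and put $\omega=-\det C$. The quantum walk $(\Psi_n)_{n\ge0}$ with inflow $\alpha\in\mathbb C^{\delta X}$ starts from $\Psi_0(\epsilon_{\xi,j})=\alpha(x_\xi)$ for all $\xi,j$ and $\Psi_0=0$ on all other arcs, and evolves by $$\Psi_{n+1}(e)=(-1)^{\tau(e)}\{c\,\Psi_n(\mathrm{is}(e)^+)+d\,\Psi_n(\bar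 e)\}\quad(e\in A_{br}),$$ $$\Psi_{n+1}(\xi^-)=a\,\Psi_n((\tilde\rho^{-1}(\xi))^+)+b\,\Psi_n(\mathrm{br}(\xi)),\qquad \Psi_{n+1}(\xi^+)=a\,\Psi_n(\xi^-)+b\,\Psi_n(\epsilon_{\xi,0}),$$ $$\Psi_{n+1}(\bar\epsilon_{\xi,0})=c\,\Psi_n(\xi^-)+d\,\Psi_n(\epsilon_{\xi,0}),\qquad \Psi_{n+1}(\epsilon_{\xi,j})=\Psi_n(\epsilon_{\xi,j+1}),\qquad \Psi_{n+1}(\bar\epsilon_{\xi,j+1})=\Psi_n(\bar\epsilon_{\xi,j}).$$ Then for each $\alpha$ the stationary state $\psi_\infty=\lim_{n\to\infty}\Psi_n$ exists (pointwise), with $\psi_\infty(\epsilon_{\xi,0})=\alpha(x_\xi)$, and there is a unique linear map $S$ on $\mathbb C^{\delta X}$ (the scattering matrix), independent of $\alpha$, such that the outflow $\beta(x_\xi)=\psi_\infty(\bar\epsilon_{\xi,0})$ equals $S\alpha$ for all $\alpha$. Define $$\eta(e)=\frac1{bc\,\omega}\,\big((S-dI)\alpha\big)\big(t(\mathrm{is}^\sharp(\bar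 e))\big)\qquad(e\in A_{br}).$$ Then, for every bridge arc $e$, $$\psi_\infty(e)=\omega\big(\eta(e)+(-1)^{\tau(e)}d\,\eta(\bar e)\big),$$ and for every facial walk $(\xi_0,e_0,\dots,\xi_{\kappa-1},e_{\kappa-1})$, $\kappa\ge1$, that is, $\xi_j\in A_{is}$ and distinct $e_j\in A_{br}$ with $\xi_j=\mathrm{is}(e_j)$ and $e_j=\mathrm{br}(\xi_{j+1})$ for all $j\in\mathbb Z_\kappa$, $$\psi_\infty(\xi_m^+)=(-1)^{\tau(e_m)}\,b\,\eta(e_m),\qquad \psi_\infty(\xi_{m+1}^-)=\omega\,b\,\eta(e_m)\qquad(m\in\mathbb Z_\kappa).$$ -/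

import Mathlib

open Filter Topology

/-- A rotation system on a simple graph `G`. Arcs are `G.Dart`: the origin of `e` is `e.fst`, its
terminus is `e.snd` and its inverse is `e.symm`. The rotation permutes, for each vertex `x`, the
arcs with terminus `x` in one single cycle; the twist is a `ZMod 2`-valued function of edges. -/
structure RotationSystem {X : Type*} (G : SimpleGraph X) where
  rot : Equiv.Perm G.Dart
  twist : G.Dart → ZMod 2
  rot_snd : ∀ e, (rot e).snd = e.snd
  rot_cyclic : ∀ e e' : G.Dart, e.snd = e'.snd → rot.SameCycle e e'
  twist_symm : ∀ e, twist e.symm = twist e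

namespace RotationSystem

section DoubleCover

variable {X : Type*} {G : SimpleGraph X} (R : RotationSystem G)

/-- The double covering graph `G^τ` on `X × ZMod 2`: `(x, j)` and `(y, k)` are adjacent iff `x` and
`y` are adjacent in `G` and `k = j + τ(x, y)`. -/
def cover : SimpleGraph (X × ZMod 2) where
  Adj p q := ∃ h : G.Adj p.1 q.1, q.2 = p.2 + R.twist ⟨(p.1, q.1), h⟩
  symm := ⟨by
    rintro p q ⟨h, hq⟩
    refine ⟨h.symm, ?_⟩
    have h1 : R.twist ⟨(q.1, p.1), h.symm⟩ = R.twist ⟨(p.1, q.1), h⟩ :=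
      R.twist_symm ⟨(p.1, q.1), h⟩
    rw [h1, hq, add_assoc, CharTwo.add_self_eq_zero, add_zero]⟩
  loopless := ⟨fun p ⟨h, _⟩ => G.irrefl h⟩

/-- The arc of `G` below an arc of `G^τ`. -/
def base (a : R.cover.Dart) : G.Dart := ⟨(a.fst.1, a.snd.1), a.adj.choose⟩

/-- The arc of `G^τ` above the arc `e` of `G` whose terminus lies in the sheet `k`. -/
def lift (e : G.Dart) (k : ZMod 2) : R.cover.Dart :=
  ⟨((e.fst, k - R.twist e), (e.snd, k)), ⟨e.adj, (sub_add_cancel k (R.twist e)).symm⟩⟩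

theorem base_lift (e : G.Dart) (k : ZMod 2) : R.base (R.lift e k) = e := rfl

theorem lift_base (a : R.cover.Dart) : R.lift (R.base a) a.snd.2 = a := by
  have h : a.snd.2 = a.fst.2 + R.twist (R.base a) := a.adj.choose_spec
  apply SimpleGraph.Dart.ext
  refine Prod.ext (Prod.ext rfl ?_) rfl
  change a.snd.2 - R.twist (R.base a) = a.fst.2
  rw [h, add_sub_cancel_right]

/-- The rotation used in the sheet `k`: `ρ` in the front sheet `0`, `ρ⁻¹` in the back sheet `1`. -/
def sheetRot (k : ZMod 2) : Equiv.Perm G.Dart := if k = 0 then R.rot else R.rot⁻¹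

/-- The rotation `ρ ⊕ ρ⁻¹` of `G^τ`. -/
def coverRot : Equiv.Perm R.cover.Dart where
  toFun a := R.lift (R.sheetRot a.snd.2 (R.base a)) a.snd.2
  invFun a := R.lift ((R.sheetRot a.snd.2).symm (R.base a)) a.snd.2
  left_inv a := by
    change R.lift ((R.sheetRot a.snd.2).symm (R.sheetRot a.snd.2 (R.base a))) a.snd.2 = a
    rw [Equiv.symm_apply_apply, lift_base]
  right_inv a := by
    change R.lift (R.sheetRot a.snd.2 ((R.sheetRot a.snd.2).symm (R.base a))) a.snd.2 = a
    rw [Equiv.apply_symm_apply, lift_base]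

theorem coverRot_lift (e : G.Dart) (k : ZMod 2) :
    R.coverRot (R.lift e k) = R.lift (R.sheetRot k e) k := rfl

theorem coverRot_zpow_lift (e : G.Dart) (k : ZMod 2) (i : ℤ) :
    (R.coverRot ^ i) (R.lift e k) = R.lift ((R.sheetRot k ^ i) e) k := by
  induction i with
  | zero => rfl
  | succ n ih =>
    rw [add_comm, zpow_one_add, zpow_one_add, Equiv.Perm.mul_apply, ih, coverRot_lift,
      Equiv.Perm.mul_apply]
  | pred n ih =>
    rw [sub_eq_neg_add, zpow_add, zpow_add, zpow_neg_one, zpow_neg_one, Equiv.Perm.mul_apply, ih,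
      Equiv.Perm.mul_apply, Equiv.Perm.inv_eq_iff_eq, coverRot_lift]
    exact congrArg (R.lift · k) ((R.sheetRot k).apply_symm_apply _).symm

theorem sheetRot_snd (e : G.Dart) (k : ZMod 2) : (R.sheetRot k e).snd = e.snd := by
  unfold sheetRot
  split_ifs
  · exact R.rot_snd e
  · have h := R.rot_snd (R.rot⁻¹ e)
    exact h.symm.trans (congrArg (fun a => a.snd) (R.rot.apply_symm_apply e))

/-- The double covering `(G^τ, ρ ⊕ ρ⁻¹, id)` of the rotation system; no edge of it is twisted. -/
def doubleCover : RotationSystem R.cover where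
  rot := R.coverRot
  twist _ := 0
  rot_snd a := Prod.ext (R.sheetRot_snd (R.base a) a.snd.2) rfl
  rot_cyclic a b h := by
    have hc : (R.sheetRot a.snd.2).SameCycle (R.base a) (R.base b) := by
      have h0 : R.rot.SameCycle (R.base a) (R.base b) := R.rot_cyclic _ _ (congrArg Prod.fst h)
      unfold sheetRot
      split_ifs
      · exact h0
      · exact h0.inv
    obtain ⟨i, hi⟩ := hc
    refine ⟨i, ?_⟩
    have h1 := R.coverRot_zpow_lift (R.base a) a.snd.2 i
    rw [hi, lift_base, h, lift_base] at h1
    exact h1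
  twist_symm _ := rfl

end DoubleCover

section BlowUp

variable {X : Type*} {G : SimpleGraph X}

/-- The vertices of the blow-up graph of `(G, ρ)` are the arcs of `G`. -/
abbrev BlowUpVertex (_R : RotationSystem G) := G.Dart

/-- The island arcs `(v, ρ(v))` of the blow-up graph, given by their origin `v`. -/
@[ext] structure Island (R : RotationSystem G) where
  o : R.BlowUpVertex

/-- The bridge arcs `(v, v̄)` of the blow-up graph, given by their origin `v`. -/
@[ext] structure Bridge (R : RotationSystem G) where
  o : R.BlowUpVertex

variable {R : RotationSystem G}

/-- The terminus of an island arc. -/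
def Island.t (ξ : R.Island) : R.BlowUpVertex := R.rot ξ.o

/-- The terminus of a bridge arc. -/
def Bridge.t (e : R.Bridge) : R.BlowUpVertex := e.o.symm

/-- The inverse of a bridge arc. -/
def Bridge.inv (e : R.Bridge) : R.Bridge := ⟨e.t⟩

/-- The preceding arc `ρ⁻¹(ξ)` in the directed cycle of an island arc. -/
def Island.prev (ξ : R.Island) : R.Island := ⟨R.rot.symm ξ.o⟩

/-- `br(ξ)`, the bridge arc whose terminus is the origin of `ξ`. -/
def Island.br (ξ : R.Island) : R.Bridge := ⟨ξ.o.symm⟩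

/-- `is(e)`, the island arc whose terminus is the origin of `e`. -/
def Bridge.isl (e : R.Bridge) : R.Island := ⟨R.rot.symm e.o⟩

/-- `is♯(e)`, the island arc whose origin is the origin of `e`. -/
def Bridge.islSharp (e : R.Bridge) : R.Island := ⟨e.o⟩

theorem Island.t_eq_o_iff (ξ ξ' : R.Island) : ξ'.t = ξ.o ↔ ξ' = ξ.prev := by
  rw [Island.ext_iff]
  exact (Equiv.eq_symm_apply R.rot).symm

theorem Island.br_iff (ξ : R.Island) (e : R.Bridge) : e.t = ξ.o ↔ e = ξ.br := by
  rw [Bridge.ext_iff]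
  exact SimpleGraph.Dart.symm_involutive.eq_iff

theorem Bridge.isl_iff (e : R.Bridge) (ξ : R.Island) : ξ.t = e.o ↔ ξ = e.isl := by
  rw [Island.ext_iff]
  exact (Equiv.eq_symm_apply R.rot).symm

theorem Bridge.islSharp_iff (e : R.Bridge) (ξ : R.Island) : ξ.o = e.o ↔ ξ = e.islSharp := by
  rw [Island.ext_iff]
  exact Iff.rfl

end BlowUp

section Walk

variable {X : Type*} {G : SimpleGraph X} (R : RotationSystem G)

/-- Vertices of `G̃(ρ, τ)`, the blow-up graph of the double covering with a tail inserted into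
every island arc (hedgehog assignment). The tail of `ξ` is the semi-infinite path with vertices
`tail ξ 0, tail ξ 1, …`; its root `tail ξ 0` is the boundary vertex on `ξ`, so that the set `δX` of
boundary vertices is indexed by the island arcs. -/
inductive TailedVertex
  | inner (v : R.doubleCover.BlowUpVertex)
  | tail (ξ : R.doubleCover.Island) (j : ℕ)

/-- Arcs of `G̃(ρ, τ)`: the bridge arcs, the quay arcs `ξ⁻` and `ξ⁺` into which the island arc `ξ`
is divided, and the arcs of the tails, `tailIn ξ j` towards the root and `tailOut ξ j` its
inverse. -/
inductive TailedArc
  | bridge (e : R.doubleCover.Bridge)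
  | quayMinus (ξ : R.doubleCover.Island)
  | quayPlus (ξ : R.doubleCover.Island)
  | tailIn (ξ : R.doubleCover.Island) (j : ℕ)
  | tailOut (ξ : R.doubleCover.Island) (j : ℕ)

variable {R}

/-- The origin of an arc of `G̃(ρ, τ)`. -/
def TailedArc.o : R.TailedArc → R.TailedVertex
  | .bridge e => .inner e.o
  | .quayMinus ξ => .inner ξ.o
  | .quayPlus ξ => .tail ξ 0
  | .tailIn ξ j => .tail ξ (j + 1)
  | .tailOut ξ j => .tail ξ j

/-- The terminus of an arc of `G̃(ρ, τ)`. -/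
def TailedArc.t : R.TailedArc → R.TailedVertex
  | .bridge e => .inner e.t
  | .quayMinus ξ => .tail ξ 0
  | .quayPlus ξ => .inner ξ.t
  | .tailIn ξ j => .tail ξ j
  | .tailOut ξ j => .tail ξ (j + 1)

variable (R)

/-- The sign `(-1)^τ(e)` of a bridge arc: the twist of the edge of `G` below it. -/
noncomputable def sign (e : R.doubleCover.Bridge) : ℂ := (-1) ^ (R.twist (R.base e.o)).val

/-- One step of the quantum walk on `G̃(ρ, τ)` with the coin `C = !![a, b; c, d]`: scattering by `C`
at the inner vertices and at the roots of the tails, free motion along the tails. -/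
noncomputable def evolve (C : Matrix (Fin 2) (Fin 2) ℂ) (Ψ : R.TailedArc → ℂ) : R.TailedArc → ℂ
  | .bridge e => R.sign e * (C 1 0 * Ψ (.quayPlus e.isl) + C 1 1 * Ψ (.bridge e.inv))
  | .quayMinus ξ => C 0 0 * Ψ (.quayPlus ξ.prev) + C 0 1 * Ψ (.bridge ξ.br)
  | .quayPlus ξ => C 0 0 * Ψ (.quayMinus ξ) + C 0 1 * Ψ (.tailIn ξ 0)
  | .tailIn ξ j => Ψ (.tailIn ξ (j + 1))
  | .tailOut ξ 0 => C 1 0 * Ψ (.quayMinus ξ) + C 1 1 * Ψ (.tailIn ξ 0)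
  | .tailOut ξ (j + 1) => Ψ (.tailOut ξ j)

/-- The initial state: the amplitude `α ξ` on all arcs of the tail of `ξ` that point towards its
root, and zero on all other arcs. -/
def initialState (α : R.doubleCover.Island → ℂ) : R.TailedArc → ℂ
  | .tailIn ξ _ => α ξ
  | _ => 0

/-- The state `Ψ_n` of the walk at time `n`. -/
noncomputable def state (C : Matrix (Fin 2) (Fin 2) ℂ) (α : R.doubleCover.Island → ℂ) (n : ℕ) :
    R.TailedArc → ℂ :=
  (R.evolve C)^[n] (R.initialState α)

/-- `ψ` is the stationary state of the walk with inflow `α`: its limit at every arc. -/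
def IsStationaryState (C : Matrix (Fin 2) (Fin 2) ℂ) (α : R.doubleCover.Island → ℂ)
    (ψ : R.TailedArc → ℂ) : Prop :=
  ∀ e, Tendsto (fun n => R.state C α n e) atTop (𝓝 (ψ e))

variable {R} in
/-- The inflow `α_in`, read on the tail arcs that end in the boundary vertices. -/
def inflow (ψ : R.TailedArc → ℂ) : R.doubleCover.Island → ℂ := fun ξ => ψ (.tailIn ξ 0)

variable {R} in
/-- The outflow `β_out`, read on the tail arcs that start in the boundary vertices. -/
def outflow (ψ : R.TailedArc → ℂ) : R.doubleCover.Island → ℂ := fun ξ => ψ (.tailOut ξ 0)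

/-- `S` is the scattering matrix on `ℂ^δX`: it maps the inflow to the outflow in each stationary
state, whatever the inflow. -/
def IsScatteringMatrix (C : Matrix (Fin 2) (Fin 2) ℂ)
    (S : (R.doubleCover.Island → ℂ) →ₗ[ℂ] (R.doubleCover.Island → ℂ)) : Prop :=
  ∀ α ψ, R.IsStationaryState C α ψ → outflow ψ = S (inflow ψ)

variable {R} in
/-- The island arc that carries the boundary vertex `t(is♯(ē))` attached to the bridge arc `e`. -/
def boundaryOf (e : R.doubleCover.Bridge) : R.doubleCover.Island := e.inv.islSharp

theorem t_quayMinus_boundaryOf (e : R.doubleCover.Bridge) :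
    (TailedArc.quayMinus e.inv.islSharp : R.TailedArc).t = .tail (boundaryOf e) 0 := rfl

/-- `ω = -det C`. -/
noncomputable def omega (C : Matrix (Fin 2) (Fin 2) ℂ) : ℂ := -C.det

variable {R} in
/-- `Q = S - d I`, with `d` the lower right entry of the coin. -/
noncomputable def Q (C : Matrix (Fin 2) (Fin 2) ℂ)
    (S : (R.doubleCover.Island → ℂ) →ₗ[ℂ] (R.doubleCover.Island → ℂ)) :
    (R.doubleCover.Island → ℂ) →ₗ[ℂ] (R.doubleCover.Island → ℂ) :=
  S - C 1 1 • LinearMap.id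

/-- `η(e) = (1 / (b c ω)) ((S - d I) α)(t(is♯(ē)))`. -/
noncomputable def eta (C : Matrix (Fin 2) (Fin 2) ℂ)
    (S : (R.doubleCover.Island → ℂ) →ₗ[ℂ] (R.doubleCover.Island → ℂ))
    (α : R.doubleCover.Island → ℂ) (e : R.doubleCover.Bridge) : ℂ :=
  1 / (C 0 1 * C 1 0 * omega C) * Q C S α (boundaryOf e)

/-- The cyclic sequence `(ξ_0, e_0, …, ξ_{κ-1}, e_{κ-1})` of island and bridge arcs is an (extended)
facial walk of the double covering: `ξ_j = is(e_j)` and `e_j = br(ξ_{j+1})`, with indices modulo the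
length `κ`, and no bridge arc is repeated within a period. -/
structure IsFacialWalk (κ : ℕ) (ξ : ZMod κ → R.doubleCover.Island)
    (e : ZMod κ → R.doubleCover.Bridge) : Prop where
  pos : 0 < κ
  island : ∀ j, ξ j = (e j).isl
  bridge : ∀ j, e j = (ξ (j + 1)).br
  injective : Function.Injective e

/-- Along a facial walk the arcs `(e_j).t` of `G^τ` that are traversed follow the usual rule: the
arc after `u` is the inverse of its image under the rotation. -/
theorem IsFacialWalk.next {κ : ℕ} {ξ : ZMod κ → R.doubleCover.Island}
    {e : ZMod κ → R.doubleCover.Bridge} (h : R.IsFacialWalk κ ξ e) (j : ZMod κ) :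
    (e (j + 1)).t = (R.doubleCover.rot (e j).t).symm := by
  have h1 : (e j).t = (ξ (j + 1)).o := ((ξ (j + 1)).br_iff (e j)).2 (h.bridge j)
  have h2 : (ξ (j + 1)).t = (e (j + 1)).o := ((e (j + 1)).isl_iff _).2 (h.island (j + 1))
  rw [h1]
  exact congrArg SimpleGraph.Dart.symm h2.symm

end Walk

end RotationSystem

/-! ### Relations between the entries of the coin -/

open scoped ComplexConjugate

/-! Existence is a dissipation argument. The bridge and quay arcs are finite in number, and
unitarity makes their energy change in one step only by what the tails bring in and carry off
(`energy_evolve`). Without inflow the energy decreases to a limit, so the outflow tends to zero;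
since `b` and `c` are nonzero, the vanishing outflow forces every amplitude to vanish
(`tendsto_iterate_evolve_zero`). Hence `1` is not an eigenvalue of the inflow-free evolution on the
finite-dimensional inner space, a fixed state exists for each inflow, and the walk converges to it.
By uniqueness of limits it depends linearly on the inflow, which gives `S`.

The formulas are then local algebra. At a root the outflow is `c ψ(ξ⁻) + d α`, so `(S - d) α = c
ψ(ξ⁻)`: thus `η` encodes the quay amplitudes (`mul_eta_eq_quayMinus`). For real `d` one has `a = -ω
d` and `bc = ω (1 - d²)`, and the equations at an inner vertex become `bc η(e) = ψ(e) - (-1)^τ(e) d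
ψ(ē)` (`mul_eta_eq_bridge`). Solving this for the pair `e`, `ē` gives the bridge amplitudes, and the
stationary equation at `e` gives the quay ones. -/

theorem unitary_fin_two_relations {C : Matrix (Fin 2) (Fin 2) ℂ}
    (hC : C ∈ Matrix.unitaryGroup (Fin 2) ℂ) :
    conj (C 0 0) * C 0 0 + conj (C 1 0) * C 1 0 = 1 ∧
    conj (C 0 0) * C 0 1 + conj (C 1 0) * C 1 1 = 0 ∧
    conj (C 0 1) * C 0 0 + conj (C 1 1) * C 1 0 = 0 ∧
    conj (C 0 1) * C 0 1 + conj (C 1 1) * C 1 1 = 1 := by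
  have h := Matrix.mem_unitaryGroup_iff'.1 hC
  have h' : ∀ i j, (star C * C) i j = (1 : Matrix (Fin 2) (Fin 2) ℂ) i j := fun i j => by rw [h]
  refine ⟨?_, ?_, ?_, ?_⟩
  · simpa [Matrix.mul_apply, Fin.sum_univ_two, Matrix.star_apply] using h' 0 0
  · simpa [Matrix.mul_apply, Fin.sum_univ_two, Matrix.star_apply] using h' 0 1
  · simpa [Matrix.mul_apply, Fin.sum_univ_two, Matrix.star_apply] using h' 1 0
  · simpa [Matrix.mul_apply, Fin.sum_univ_two, Matrix.star_apply] using h' 1 1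

theorem unitary_fin_two_norm_sq {C : Matrix (Fin 2) (Fin 2) ℂ}
    (hC : C ∈ Matrix.unitaryGroup (Fin 2) ℂ) (p q : ℂ) :
    ‖C 0 0 * p + C 0 1 * q‖ ^ 2 + ‖C 1 0 * p + C 1 1 * q‖ ^ 2 = ‖p‖ ^ 2 + ‖q‖ ^ 2 := by
  obtain ⟨h1, h2, h3, h4⟩ := unitary_fin_two_relations hC
  have key : ∀ z : ℂ, ((‖z‖ ^ 2 : ℝ) : ℂ) = conj z * z := fun z => by
    rw [Complex.conj_mul']; push_cast; rfl
  apply Complex.ofReal_injective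
  rw [Complex.ofReal_add, Complex.ofReal_add, key, key, key, key]
  simp only [map_add, map_mul]
  linear_combination (conj p * p) * h1 + (conj p * q) * h2 + (conj q * p) * h3 + (conj q * q) * h4

namespace RotationSystem

/-- Comparing the inverse with the adjoint of a unitary matrix gives `a = det C · conj d`, and `d`
is real. -/
theorem coin_eq_neg_omega_mul {C : Matrix (Fin 2) (Fin 2) ℂ}
    (hC : C ∈ Matrix.unitaryGroup (Fin 2) ℂ) (hd : (C 1 1).im = 0) :
    C 0 0 = -(omega C * C 1 1) := by
  obtain ⟨-, -, h3, h4⟩ := unitary_fin_two_relations hC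
  rw [Complex.conj_eq_iff_im.2 hd] at h3 h4
  rw [omega, Matrix.det_fin_two]
  linear_combination -(C 0 0) * h4 + C 0 1 * h3

theorem coin_off_diagonal_eq {C : Matrix (Fin 2) (Fin 2) ℂ}
    (hC : C ∈ Matrix.unitaryGroup (Fin 2) ℂ) (hd : (C 1 1).im = 0) :
    C 0 1 * C 1 0 = omega C * (1 - C 1 1 ^ 2) := by
  have h := coin_eq_neg_omega_mul hC hd
  have h' : omega C = -(C 0 0 * C 1 1 - C 0 1 * C 1 0) := by rw [omega, Matrix.det_fin_two]
  linear_combination -h' + C 1 1 * h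

/-! ### Finiteness, signs and linearity of the evolution -/

variable {X : Type*} {G : SimpleGraph X} (R : RotationSystem G)
  {C : Matrix (Fin 2) (Fin 2) ℂ}

instance [Finite X] : Finite G.Dart :=
  Finite.of_injective (fun e : G.Dart => e.toProd) fun _ _ h => SimpleGraph.Dart.ext _ _ h

/-- Island arcs are determined by their origins. -/
def islandEquiv : R.Island ≃ G.Dart := ⟨fun ξ => ξ.o, fun v => ⟨v⟩, fun _ => rfl, fun _ => rfl⟩

/-- Bridge arcs are determined by their origins. -/
def bridgeEquiv : R.Bridge ≃ G.Dart := ⟨fun e => e.o, fun v => ⟨v⟩, fun _ => rfl, fun _ => rfl⟩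

instance [Finite X] : Finite R.Island := Finite.of_equiv _ R.islandEquiv.symm

instance [Finite X] : Finite R.Bridge := Finite.of_equiv _ R.bridgeEquiv.symm

theorem sign_eq_or (e : R.doubleCover.Bridge) : R.sign e = 1 ∨ R.sign e = -1 :=
  neg_one_pow_eq_or ℂ _

theorem sign_mul_self (e : R.doubleCover.Bridge) : R.sign e * R.sign e = 1 := by
  rcases R.sign_eq_or e with h | h <;> rw [h] <;> norm_num

theorem norm_sign (e : R.doubleCover.Bridge) : ‖R.sign e‖ = 1 := by
  rcases R.sign_eq_or e with h | h <;> rw [h] <;> norm_num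

theorem sign_inv (e : R.doubleCover.Bridge) : R.sign e.inv = R.sign e := by
  unfold sign
  rw [← R.twist_symm (R.base e.o)]
  rfl

theorem inv_inv (e : R.Bridge) : e.inv.inv = e := Bridge.ext (SimpleGraph.Dart.symm_symm e.o)

theorem evolve_add (Φ Ψ : R.TailedArc → ℂ) :
    R.evolve C (Φ + Ψ) = R.evolve C Φ + R.evolve C Ψ := by
  funext e
  rcases e with e | ξ | ξ | ⟨ξ, j⟩ | ⟨ξ, _ | j⟩ <;> simp only [evolve, Pi.add_apply] <;> ring

theorem evolve_smul (k : ℂ) (Ψ : R.TailedArc → ℂ) :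
    R.evolve C (k • Ψ) = k • R.evolve C Ψ := by
  funext e
  rcases e with e | ξ | ξ | ⟨ξ, j⟩ | ⟨ξ, _ | j⟩ <;>
    simp only [evolve, Pi.smul_apply, smul_eq_mul] <;> ring

variable (C) in
/-- The evolution of the walk as a linear map. -/
noncomputable def evolveLinear : (R.TailedArc → ℂ) →ₗ[ℂ] (R.TailedArc → ℂ) where
  toFun := R.evolve C
  map_add' := R.evolve_add
  map_smul' := R.evolve_smul

theorem iterate_evolve (Ψ : R.TailedArc → ℂ) (n : ℕ) :
    (R.evolve C)^[n] Ψ = (R.evolveLinear C ^ n) Ψ :=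
  (Module.End.pow_apply (R.evolveLinear C) n Ψ).symm

/-! ### Energy balance and decay without inflow -/

section Decay

/-- The squared norm of a state on the bridge and quay arcs. -/
noncomputable def energy (Ψ : R.TailedArc → ℂ) : ℝ :=
  (∑ᶠ e, ‖Ψ (.bridge e)‖ ^ 2 + ∑ᶠ ξ, ‖Ψ (.quayMinus ξ)‖ ^ 2) + ∑ᶠ ξ, ‖Ψ (.quayPlus ξ)‖ ^ 2

theorem energy_nonneg (Ψ : R.TailedArc → ℂ) : 0 ≤ R.energy Ψ :=
  add_nonneg (add_nonneg (finsum_nonneg fun _ => sq_nonneg _) (finsum_nonneg fun _ => sq_nonneg _))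
    (finsum_nonneg fun _ => sq_nonneg _)

theorem iterate_evolve_tailIn {Φ : R.TailedArc → ℂ} (hΦ : ∀ ξ j, Φ (.tailIn ξ j) = 0) (n : ℕ) :
    ∀ ξ j, (R.evolve C)^[n] Φ (.tailIn ξ j) = 0 := by
  induction n with
  | zero => exact hΦ
  | succ n ih =>
    intro ξ j
    rw [Function.iterate_succ_apply']
    exact ih ξ (j + 1)

variable [Finite X]

/-- At each root and each inner vertex the coin is an isometry from the two incoming to the two
outgoing amplitudes, and the twist signs have modulus one. -/
theorem energy_evolve (hC : C ∈ Matrix.unitaryGroup (Fin 2) ℂ) (Ψ : R.TailedArc → ℂ) :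
    R.energy (R.evolve C Ψ) + ∑ᶠ ξ, ‖R.evolve C Ψ (.tailOut ξ 0)‖ ^ 2 =
      R.energy Ψ + ∑ᶠ ξ, ‖Ψ (.tailIn ξ 0)‖ ^ 2 := by
  have hroot : ∑ᶠ ξ, ‖R.evolve C Ψ (.quayPlus ξ)‖ ^ 2 +
      ∑ᶠ ξ, ‖R.evolve C Ψ (.tailOut ξ 0)‖ ^ 2 =
      ∑ᶠ ξ, ‖Ψ (.quayMinus ξ)‖ ^ 2 + ∑ᶠ ξ, ‖Ψ (.tailIn ξ 0)‖ ^ 2 := by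
    rw [← finsum_add_distrib (Set.toFinite _) (Set.toFinite _),
      ← finsum_add_distrib (Set.toFinite _) (Set.toFinite _)]
    exact finsum_congr fun ξ => unitary_fin_two_norm_sq hC _ _
  have hinner : ∑ᶠ e, ‖R.evolve C Ψ (.bridge e)‖ ^ 2 + ∑ᶠ ξ, ‖R.evolve C Ψ (.quayMinus ξ)‖ ^ 2 =
      ∑ᶠ e, ‖Ψ (.bridge e)‖ ^ 2 + ∑ᶠ ξ, ‖Ψ (.quayPlus ξ)‖ ^ 2 := by
    -- All four sums are reindexed by the blow-up vertex `v` where the scattering takes place: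
    -- outgoing arcs by their origin, incoming arcs by their terminus.
    have h1 : ∑ᶠ e, ‖R.evolve C Ψ (.bridge e)‖ ^ 2 =
        ∑ᶠ v, ‖R.evolve C Ψ (.bridge ⟨v⟩)‖ ^ 2 :=
      (finsum_comp_equiv R.doubleCover.bridgeEquiv.symm).symm
    have h2 : ∑ᶠ ξ, ‖R.evolve C Ψ (.quayMinus ξ)‖ ^ 2 =
        ∑ᶠ v, ‖R.evolve C Ψ (.quayMinus ⟨v⟩)‖ ^ 2 :=
      (finsum_comp_equiv R.doubleCover.islandEquiv.symm).symm
    have h3 : ∑ᶠ e, ‖Ψ (.bridge e)‖ ^ 2 = ∑ᶠ v : R.cover.Dart, ‖Ψ (.bridge ⟨v.symm⟩)‖ ^ 2 :=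
      (finsum_comp_equiv ((SimpleGraph.Dart.symm_involutive.toPerm _).trans
        R.doubleCover.bridgeEquiv.symm)).symm
    have h4 : ∑ᶠ ξ, ‖Ψ (.quayPlus ξ)‖ ^ 2 =
        ∑ᶠ v, ‖Ψ (.quayPlus ⟨R.doubleCover.rot.symm v⟩)‖ ^ 2 :=
      (finsum_comp_equiv (R.doubleCover.rot.symm.trans R.doubleCover.islandEquiv.symm)).symm
    rw [h1, h2, h3, h4, ← finsum_add_distrib (Set.toFinite _) (Set.toFinite _),
      ← finsum_add_distrib (Set.toFinite _) (Set.toFinite _)]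
    refine finsum_congr fun v => ?_
    have h := unitary_fin_two_norm_sq hC (Ψ (.quayPlus ⟨R.doubleCover.rot.symm v⟩))
      (Ψ (.bridge ⟨v.symm⟩))
    have hb : ‖R.evolve C Ψ (.bridge ⟨v⟩)‖ = ‖C 1 0 * Ψ (.quayPlus ⟨R.doubleCover.rot.symm v⟩) +
        C 1 1 * Ψ (.bridge ⟨v.symm⟩)‖ := by
      rw [evolve, norm_mul, norm_sign, one_mul]
      rfl
    have hq : ‖R.evolve C Ψ (.quayMinus ⟨v⟩)‖ =
        ‖C 0 0 * Ψ (.quayPlus ⟨R.doubleCover.rot.symm v⟩) + C 0 1 * Ψ (.bridge ⟨v.symm⟩)‖ := rfl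
    rw [hb, hq, add_comm, h, add_comm]
  unfold energy
  linarith

theorem tendsto_iterate_evolve_zero (hC : C ∈ Matrix.unitaryGroup (Fin 2) ℂ)
    (hb : C 0 1 ≠ 0) (hc : C 1 0 ≠ 0) {Φ : R.TailedArc → ℂ}
    (hΦ : ∀ ξ j, Φ (.tailIn ξ j) = 0) (e : R.TailedArc) :
    Tendsto (fun n => (R.evolve C)^[n] Φ e) atTop (𝓝 0) := by
  set Ψ : ℕ → R.TailedArc → ℂ := fun n => (R.evolve C)^[n] Φ with hΨ
  have hs : ∀ n, Ψ (n + 1) = R.evolve C (Ψ n) := fun n => Function.iterate_succ_apply' _ _ _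
  have hin : ∀ n ξ j, Ψ n (.tailIn ξ j) = 0 := R.iterate_evolve_tailIn hΦ
  have henergy : ∀ n, R.energy (Ψ (n + 1)) + ∑ᶠ ξ, ‖Ψ (n + 1) (.tailOut ξ 0)‖ ^ 2 =
      R.energy (Ψ n) := fun n => by
    rw [hs, R.energy_evolve hC]
    simp [hin]
  have hanti : Antitone fun n => R.energy (Ψ n) := antitone_nat_of_succ_le fun n => by
    rw [← henergy n]
    exact le_add_of_nonneg_right (finsum_nonneg fun _ => sq_nonneg _)
  have hlim := tendsto_atTop_ciInf hanti
    ⟨0, by rintro _ ⟨n, rfl⟩; exact R.energy_nonneg _⟩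
  -- The outflow is the difference of consecutive terms of a convergent sequence.
  have hloss : Tendsto (fun n => ∑ᶠ ξ, ‖Ψ (n + 1) (.tailOut ξ 0)‖ ^ 2) atTop (𝓝 0) := by
    have h := hlim.sub (hlim.comp (tendsto_add_atTop_nat 1))
    rw [sub_self] at h
    refine h.congr fun n => ?_
    have := henergy n
    simp only [Function.comp_apply]
    linarith
  have hout0 : ∀ ξ, Tendsto (fun n => Ψ (n + 1) (.tailOut ξ 0)) atTop (𝓝 0) := fun ξ => by
    have hsq : Tendsto (fun n => ‖Ψ (n + 1) (.tailOut ξ 0)‖ ^ 2) atTop (𝓝 0) :=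
      squeeze_zero (fun _ => sq_nonneg _)
        (fun n => single_le_finsum (f := fun ξ => ‖Ψ (n + 1) (.tailOut ξ 0)‖ ^ 2) ξ (Set.toFinite _)
          fun _ => sq_nonneg _) hloss
    have hsqrt := hsq.sqrt
    simp only [Real.sqrt_zero, Real.sqrt_sq (norm_nonneg _)] at hsqrt
    exact tendsto_zero_iff_norm_tendsto_zero.2 hsqrt
  -- Without inflow the outflow is `c` times the previous amplitude on `ξ⁻`, and `c ≠ 0`.
  have hminus : ∀ ξ, Tendsto (fun n => Ψ n (.quayMinus ξ)) atTop (𝓝 0) := fun ξ => by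
    have h := (hout0 ξ).const_mul (C 1 0)⁻¹
    rw [mul_zero] at h
    refine h.congr fun n => ?_
    rw [hs, evolve, hin, mul_zero, add_zero, inv_mul_cancel_left₀ hc]
  have hplus : ∀ ξ, Tendsto (fun n => Ψ n (.quayPlus ξ)) atTop (𝓝 0) := fun ξ => by
    refine (tendsto_add_atTop_iff_nat 1).1 ?_
    have h := (hminus ξ).const_mul (C 0 0)
    rw [mul_zero] at h
    refine h.congr fun n => ?_
    rw [hs, evolve, hin, mul_zero, add_zero]
  -- The equation for the quay arc leaving `t(e)` is solved for its bridge term, using `b ≠ 0`.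
  have hbr : ∀ e, Tendsto (fun n => Ψ n (.bridge e)) atTop (𝓝 0) := fun e => by
    have h := (((hminus e.inv.islSharp).comp (tendsto_add_atTop_nat 1)).sub
      ((hplus e.inv.islSharp.prev).const_mul (C 0 0))).const_mul (C 0 1)⁻¹
    rw [mul_zero, sub_zero, mul_zero] at h
    refine h.congr fun n => ?_
    have hbr : e.inv.islSharp.br = e := R.doubleCover.inv_inv e
    simp only [Function.comp_apply]
    rw [hs, evolve, add_sub_cancel_left, inv_mul_cancel_left₀ hb, hbr]
  have hout : ∀ ξ j, Tendsto (fun n => Ψ n (.tailOut ξ j)) atTop (𝓝 0) := fun ξ j => by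
    induction j with
    | zero => exact (tendsto_add_atTop_iff_nat 1).1 (hout0 ξ)
    | succ j ih =>
      refine (tendsto_add_atTop_iff_nat 1).1 (ih.congr fun n => ?_)
      rw [hs, evolve]
  rcases e with e | ξ | ξ | ⟨ξ, j⟩ | ⟨ξ, j⟩
  · exact hbr e
  · exact hminus ξ
  · exact hplus ξ
  · exact tendsto_const_nhds.congr fun n => (hin n ξ j).symm
  · exact hout ξ j

end Decay

/-! ### Existence of the stationary state -/

section StationaryState

/-- Amplitudes on the bridge arcs and on the two quay arcs of each island arc. -/
abbrev InnerState : Type _ :=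
  (R.doubleCover.Bridge → ℂ) × (R.doubleCover.Island → ℂ) × (R.doubleCover.Island → ℂ)

variable (C) in
/-- The state with given amplitudes on the bridge and quay arcs, constant inflow along each tail,
and the outflow that these produce. -/
def fill (α : R.doubleCover.Island → ℂ) (x : R.InnerState) : R.TailedArc → ℂ
  | .bridge e => x.1 e
  | .quayMinus ξ => x.2.1 ξ
  | .quayPlus ξ => x.2.2 ξ
  | .tailIn ξ _ => α ξ
  | .tailOut ξ _ => C 1 0 * x.2.1 ξ + C 1 1 * α ξ

variable (C) in
/-- The amplitudes after one step on the bridge and quay arcs. -/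
noncomputable def innerEvolve (α : R.doubleCover.Island → ℂ) (x : R.InnerState) : R.InnerState :=
  (fun e => R.evolve C (R.fill C α x) (.bridge e),
    fun ξ => R.evolve C (R.fill C α x) (.quayMinus ξ),
    fun ξ => R.evolve C (R.fill C α x) (.quayPlus ξ))

theorem evolve_fill {α : R.doubleCover.Island → ℂ} {x : R.InnerState}
    (h : R.innerEvolve C α x = x) : R.evolve C (R.fill C α x) = R.fill C α x := by
  funext e
  rcases e with e | ξ | ξ | ⟨ξ, j⟩ | ⟨ξ, _ | j⟩
  · exact congrFun (congrArg Prod.fst h) e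
  · exact congrFun (congrArg (fun y => y.2.1) h) ξ
  · exact congrFun (congrArg (fun y => y.2.2) h) ξ
  all_goals rfl

theorem innerEvolve_eq_add (α : R.doubleCover.Island → ℂ) (x : R.InnerState) :
    R.innerEvolve C α x = R.innerEvolve C 0 x + R.innerEvolve C α 0 := by
  refine Prod.ext ?_ (Prod.ext ?_ ?_) <;> funext e <;> simp [innerEvolve, evolve, fill]

variable (C) in
/-- The defect `x - E x`, where `E` is the evolution without inflow. -/
noncomputable def innerDefect : R.InnerState →ₗ[ℂ] R.InnerState where
  toFun x := x - R.innerEvolve C 0 x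
  map_add' x y := by
    refine Prod.ext ?_ (Prod.ext ?_ ?_) <;> funext e <;> simp [innerEvolve, evolve, fill] <;> ring
  map_smul' k x := by
    refine Prod.ext ?_ (Prod.ext ?_ ?_) <;> funext e <;> simp [innerEvolve, evolve, fill] <;> ring

variable [Finite X]

/-- A fixed state without inflow is constant in time and also decays, so it vanishes. -/
theorem innerDefect_injective (hC : C ∈ Matrix.unitaryGroup (Fin 2) ℂ)
    (hb : C 0 1 ≠ 0) (hc : C 1 0 ≠ 0) : Function.Injective (R.innerDefect C) := by
  refine (injective_iff_map_eq_zero _).2 fun x hx => ?_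
  have hfix : R.evolve C (R.fill C 0 x) = R.fill C 0 x := R.evolve_fill (sub_eq_zero.1 hx).symm
  have hzero : ∀ e, R.fill C 0 x e = 0 := fun e => by
    have h := R.tendsto_iterate_evolve_zero hC hb hc (Φ := R.fill C 0 x) (fun _ _ => rfl) e
    simp only [Function.iterate_fixed hfix] at h
    exact tendsto_nhds_unique tendsto_const_nhds h
  exact Prod.ext (funext fun e => hzero (.bridge e))
    (Prod.ext (funext fun ξ => hzero (.quayMinus ξ)) (funext fun ξ => hzero (.quayPlus ξ)))

theorem exists_evolve_eq_self (hC : C ∈ Matrix.unitaryGroup (Fin 2) ℂ)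
    (hb : C 0 1 ≠ 0) (hc : C 1 0 ≠ 0) (α : R.doubleCover.Island → ℂ) :
    ∃ ψ : R.TailedArc → ℂ, R.evolve C ψ = ψ ∧ ∀ ξ j, ψ (.tailIn ξ j) = α ξ := by
  obtain ⟨x, hx⟩ := LinearMap.injective_iff_surjective.1 (R.innerDefect_injective hC hb hc)
    (R.innerEvolve C α 0)
  refine ⟨R.fill C α x, R.evolve_fill ?_, fun _ _ => rfl⟩
  rw [innerEvolve_eq_add, ← hx]
  exact add_sub_cancel _ _

theorem exists_isStationaryState (hC : C ∈ Matrix.unitaryGroup (Fin 2) ℂ)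
    (hb : C 0 1 ≠ 0) (hc : C 1 0 ≠ 0) (α : R.doubleCover.Island → ℂ) :
    ∃ ψ, R.IsStationaryState C α ψ := by
  obtain ⟨ψ, hfix, hin⟩ := R.exists_evolve_eq_self hC hb hc α
  refine ⟨ψ, fun e => ?_⟩
  -- The initial and the fixed state agree on all incoming tail arcs, so their difference has no
  -- inflow and decays.
  have h := R.tendsto_iterate_evolve_zero hC hb hc (Φ := R.initialState α - ψ)
    (fun ξ j => by rw [Pi.sub_apply, hin]; exact sub_self _) e
  have h' := h.add_const (ψ e)
  rw [zero_add] at h'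
  refine h'.congr fun n => ?_
  rw [iterate_evolve, map_sub, ← iterate_evolve, ← iterate_evolve, Function.iterate_fixed hfix,
    Pi.sub_apply, sub_add_cancel]
  rfl

end StationaryState

/-! ### Consequences of stationarity and the scattering matrix -/

section Limits

variable {R} {α : R.doubleCover.Island → ℂ} {ψ : R.TailedArc → ℂ}

theorem IsStationaryState.unique (h : R.IsStationaryState C α ψ) {φ : R.TailedArc → ℂ}
    (h' : R.IsStationaryState C α φ) : φ = ψ :=
  funext fun e => tendsto_nhds_unique (h' e) (h e)

theorem initialState_add (α β : R.doubleCover.Island → ℂ) :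
    R.initialState (α + β) = R.initialState α + R.initialState β := by
  funext e
  cases e <;> simp [initialState]

theorem initialState_smul (k : ℂ) (α : R.doubleCover.Island → ℂ) :
    R.initialState (k • α) = k • R.initialState α := by
  funext e
  cases e <;> simp [initialState]

theorem IsStationaryState.add {β : R.doubleCover.Island → ℂ} {φ : R.TailedArc → ℂ}
    (h : R.IsStationaryState C α ψ) (h' : R.IsStationaryState C β φ) :
    R.IsStationaryState C (α + β) (ψ + φ) := fun e => by
  refine ((h e).add (h' e)).congr fun n => ?_
  simp only [state, iterate_evolve, initialState_add, map_add, Pi.add_apply]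

theorem IsStationaryState.smul (k : ℂ) (h : R.IsStationaryState C α ψ) :
    R.IsStationaryState C (k • α) (k • ψ) := fun e => by
  refine ((h e).const_mul k).congr fun n => ?_
  simp only [state, iterate_evolve, initialState_smul, map_smul, Pi.smul_apply, smul_eq_mul]

/-- Each new amplitude involves at most two old ones; continuity in the product topology lets
pointwise limits be fixed states. -/
theorem continuous_evolve : Continuous (R.evolve C) := by
  refine continuous_pi fun e => ?_
  rcases e with e | ξ | ξ | ⟨ξ, j⟩ | ⟨ξ, _ | j⟩ <;> simp only [evolve] <;> fun_prop

theorem IsStationaryState.evolve_eq (h : R.IsStationaryState C α ψ) : R.evolve C ψ = ψ := by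
  have hlim : Tendsto (fun n => R.state C α n) atTop (𝓝 ψ) := tendsto_pi_nhds.2 h
  refine tendsto_nhds_unique (((continuous_evolve (C := C)).tendsto ψ).comp hlim)
    ((hlim.comp (tendsto_add_atTop_nat 1)).congr fun n => ?_)
  exact Function.iterate_succ_apply' _ _ _

theorem state_tailIn (n : ℕ) (ξ : R.doubleCover.Island) (j : ℕ) :
    R.state C α n (.tailIn ξ j) = α ξ := by
  induction n generalizing j with
  | zero => rfl
  | succ n ih =>
    rw [state, Function.iterate_succ_apply']
    exact ih (j + 1)

theorem IsStationaryState.inflow_eq (h : R.IsStationaryState C α ψ) : inflow ψ = α :=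
  funext fun ξ => tendsto_nhds_unique (h (.tailIn ξ 0))
    (tendsto_const_nhds.congr fun n => (state_tailIn n ξ 0).symm)

theorem existsUnique_isScatteringMatrix
    (hex : ∀ α : R.doubleCover.Island → ℂ, ∃ ψ, R.IsStationaryState C α ψ) :
    ∃! S, R.IsScatteringMatrix C S := by
  choose ψ hψ using hex
  refine ⟨{ toFun := fun α => outflow (ψ α), map_add' := fun α β => ?_, map_smul' := fun k α => ?_ },
    fun α φ hφ => ?_, fun S hS => LinearMap.ext fun α => ?_⟩
  · rw [((hψ α).add (hψ β)).unique (hψ (α + β))]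
    rfl
  · rw [((hψ α).smul k).unique (hψ (k • α))]
    rfl
  · rw [hφ.inflow_eq, (hψ α).unique hφ]
    rfl
  -- Every `α` is the inflow of some stationary state, so `S` is determined everywhere.
  · rw [← (hψ α).inflow_eq, ← hS α _ (hψ α), (hψ α).inflow_eq]
    rfl

variable {S : (R.doubleCover.Island → ℂ) →ₗ[ℂ] (R.doubleCover.Island → ℂ)}

theorem mul_eta_eq_quayMinus (hbc : C 0 1 * C 1 0 ≠ 0) (hω : omega C ≠ 0)
    (hS : R.IsScatteringMatrix C S) (h : R.IsStationaryState C α ψ) (e : R.doubleCover.Bridge) :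
    omega C * C 0 1 * R.eta C S α e = ψ (.quayMinus e.inv.islSharp) := by
  have hQ : Q C S α (boundaryOf e) = C 1 0 * ψ (.quayMinus e.inv.islSharp) := by
    have h1 := hS α ψ h
    rw [h.inflow_eq] at h1
    have h2 := congrFun h.evolve_eq (.tailOut (boundaryOf e) 0)
    have h3 : ψ (.tailIn (boundaryOf e) 0) = α (boundaryOf e) := congrFun h.inflow_eq _
    rw [evolve, h3] at h2
    rw [Q, LinearMap.sub_apply, ← h1, Pi.sub_apply, outflow, ← h2]
    exact add_sub_cancel_right _ _
  have hb := left_ne_zero_of_mul hbc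
  have hc := right_ne_zero_of_mul hbc
  rw [eta, hQ]
  field_simp

theorem mul_eta_eq_bridge (hC : C ∈ Matrix.unitaryGroup (Fin 2) ℂ) (hd : (C 1 1).im = 0)
    (hbc : C 0 1 * C 1 0 ≠ 0) (hω : omega C ≠ 0)
    (hS : R.IsScatteringMatrix C S) (h : R.IsStationaryState C α ψ) (e : R.doubleCover.Bridge) :
    C 0 1 * C 1 0 * R.eta C S α e =
      ψ (.bridge e) - R.sign e * C 1 1 * ψ (.bridge e.inv) := by
  have h1 := mul_eta_eq_quayMinus hbc hω hS h e
  have h2 : C 0 0 * ψ (.quayPlus e.inv.isl) + C 0 1 * ψ (.bridge e) =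
      ψ (.quayMinus e.inv.islSharp) := by
    have hbr : e.inv.islSharp.br = e := R.doubleCover.inv_inv e
    have h2 := congrFun h.evolve_eq (.quayMinus e.inv.islSharp)
    rw [evolve, hbr] at h2
    exact h2
  have h3 := congrFun h.evolve_eq (.bridge e.inv)
  rw [evolve, R.sign_inv, R.doubleCover.inv_inv] at h3
  have ha := coin_eq_neg_omega_mul hC hd
  have hdet := coin_off_diagonal_eq hC hd
  have hs := R.sign_mul_self e
  apply mul_left_cancel₀ hω
  -- The amplitude on the quay arc into `t(e)` is eliminated between the equations for the two arcs
  -- leaving that vertex.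
  linear_combination C 1 0 * h1 - C 1 0 * h2 + C 1 0 * ψ (.quayPlus e.inv.isl) * ha
    + ψ (.bridge e) * hdet - omega C * C 1 1 * R.sign e * h3
    + omega C * C 1 1 * (C 1 0 * ψ (.quayPlus e.inv.isl) + C 1 1 * ψ (.bridge e)) * hs

end Limits

end RotationSystem

/-! ### The main theorem -/

theorem proposition7 {X : Type*} [Finite X] {G : SimpleGraph X} (R : RotationSystem G)
    (C : Matrix (Fin 2) (Fin 2) ℂ) (hC : C ∈ Matrix.unitaryGroup (Fin 2) ℂ)
    (hd : (C 1 1).im = 0) (hbc : C 0 1 * C 1 0 ≠ 0) :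
    (∃! S, R.IsScatteringMatrix C S) ∧
    ∀ α : R.doubleCover.Island → ℂ,
      (∃! ψ, R.IsStationaryState C α ψ) ∧
      ∀ S ψ, R.IsScatteringMatrix C S → R.IsStationaryState C α ψ →
        RotationSystem.inflow ψ = α ∧
        (∀ e : R.doubleCover.Bridge,
          ψ (.bridge e) =
            RotationSystem.omega C *
              (R.eta C S α e + R.sign e * C 1 1 * R.eta C S α e.inv)) ∧
        (∀ (κ : ℕ) (ξ : ZMod κ → R.doubleCover.Island) (e : ZMod κ → R.doubleCover.Bridge),
          R.IsFacialWalk κ ξ e → ∀ m : ZMod κ,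
            ψ (.quayPlus (ξ m)) = R.sign (e m) * C 0 1 * R.eta C S α (e m) ∧
            ψ (.quayMinus (ξ (m + 1))) =
              RotationSystem.omega C * C 0 1 * R.eta C S α (e m)) := by
  have hb := left_ne_zero_of_mul hbc
  have hc := right_ne_zero_of_mul hbc
  have hdet := RotationSystem.coin_off_diagonal_eq hC hd
  have hω : RotationSystem.omega C ≠ 0 := left_ne_zero_of_mul (hdet ▸ hbc)
  have hex := R.exists_isStationaryState hC hb hc
  refine ⟨RotationSystem.existsUnique_isScatteringMatrix hex, fun α => ⟨?_, ?_⟩⟩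
  · obtain ⟨ψ, hψ⟩ := hex α
    exact ⟨ψ, hψ, fun φ hφ => hψ.unique hφ⟩
  intro S ψ hS hψ
  have hη := RotationSystem.mul_eta_eq_bridge hC hd hbc hω hS hψ
  refine ⟨hψ.inflow_eq, fun e => ?_, fun κ ξ e hwalk m => ⟨?_, ?_⟩⟩
  · have h1 := hη e
    have h2 := hη e.inv
    rw [R.sign_inv, R.doubleCover.inv_inv] at h2
    have hs := R.sign_mul_self e
    apply mul_left_cancel₀ hbc
    -- In `η(e) + (-1)^τ(e) d η(ē)` the terms in `ψ(ē)` cancel and `(1 - d²) ψ(e)` remains, up to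
    -- the factor `bc`.
    linear_combination -RotationSystem.omega C * h1
      - RotationSystem.omega C * R.sign e * C 1 1 * h2 + ψ (.bridge e) * hdet
      + RotationSystem.omega C * C 1 1 ^ 2 * ψ (.bridge e) * hs
  · have h1 := hη (e m)
    have h2 := congrFun hψ.evolve_eq (.bridge (e m))
    rw [RotationSystem.evolve, ← hwalk.island m] at h2
    have hs := R.sign_mul_self (e m)
    apply mul_left_cancel₀ hc
    -- The term `d ψ(ē)` cancels against the evolution equation at `e`, leaving only the quay
    -- amplitude.
    linear_combination -R.sign (e m) * h1 + R.sign (e m) * h2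
      - (C 1 0 * ψ (.quayPlus (ξ m))) * hs
  · rw [RotationSystem.mul_eta_eq_quayMinus hbc hω hS hψ]
    congr 2
    exact RotationSystem.Island.ext
      (((ξ (m + 1)).br_iff (e m)).2 (hwalk.bridge m)).symm
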